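/- **Setting.** Let $G=(V,E)$ be a finite, non-empty, loop-free directed graph (the network), let $t_1,\dots,t_N\in V$ be distinct vertices of in-degree $0$ (transmitters), and let $R_1,\dots,R_N\subseteq V$ be sets of vertices of out-degree $0$ (the receivers belonging to $t_1,\dots,t_N$). All other vertices are called relays. *Binary linear network code.* For input bits $x=(x_1,\dots,x_N)\in\mathbb F_2^N$, a message assignment is a map $m:V\to\mathbb F_2$ with $m(t_j)=x_j$ for all $j$ and $m(v)=\sum_{u:(u,v)\in E}m(u)$ (sum mod $2$) for every $v\notin\{t_1,\dots,t_N\}$; that is, each transmitter broadcasts its bit on all its outgoing edges, each relay broadcasts the mod-2 sum of its inputs on all its outgoing edges, and each receiver computes the mod-2 sum of its inputs. We say that $(G,(t_j),(R_j))$ is a binary linear network code for the multiple multicast problem if for every $x\in\mathbb F_2^N$ there is exactly one message assignment (this is automatic if $G$ is acyclic), and in it $m(r)=x_j$ for all $j$ and all $r\in R_j$. (Multiple unicast is the case $|R_j|=1$ for all $j$.) *QLNC circuit.* There is one qubit for each vertex. In the first time step every qubit is prepared in $|0\rangle$ or $|+\rangle$. In each further time step (layer) every qubit takes part in at most one of the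 following operations: a CNOT, a measurement of $X$, a measurement of $Z$, or a Pauli gate $X^aZ^b$ whose exponents $a,b\in\{0,1\}$ may be arbitrary functions of the measurement outcomes of earlier layers. The quantum depth is the number of time steps, including the preparation step. The circuit distributes the Bell/GHZ states if, for every sequence of measurement outcomes that occurs with non-zero probability, the final state is, up to a global phase, the tensor product over $j=1,\dots,N$ of the states $\tfrac1{\sqrt2}(|0\cdots0\rangle+|1\cdots1\rangle)$ on $\{t_j\}\cup R_j$ (this is $|\Phi^+\rangle$ if $|R_j|=1$, a GHZ state if $|R_j|\ge2$, and $|+\rangle$ if $R_j=\emptyset$), with some state of the relays. **Theorem.** If $(G,(t_j),(R_j))$ is a binary linear network code for the multiple multicast problem, then there is a QLNC circuit, all of whose CNOTs act along edges of $G$ (control at the tail, target at the head), that distributes the Bell/GHZ states and has quantum depth at most $$2(\chi-1)(\delta+2)+1,$$ where $\chi$ is the chromatic number of the undirected graph underlying $G$ and $\delta$ is the maximum of all in-degrees and out-degrees of vertices of $G$. -/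

import Mathlib

namespace QLNC

/-! ### Classical binary linear network codes -/

section NetworkCode

variable {V : Type*} [Fintype V] {N : ℕ}

open Classical in
/-- `m v` is the bit that the node `v` transmits (or, for a receiver, computes) when the
transmitters `t j` hold the bits `x j`: transmitter `t j` broadcasts `x j`, and every other node
broadcasts (computes) the sum modulo 2 of the bits on its incoming edges. -/
def IsMessageAssignment (G : Digraph V) (t : Fin N → V) (x : Fin N → ZMod 2)
    (m : V → ZMod 2) : Prop :=
  (∀ j, m (t j) = x j) ∧
    ∀ v, v ∉ Set.range t → m v = ∑ u ∈ Finset.univ.filter (fun u => G.Adj u v), m u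

/-- The network `G`, with the transmitters `t j` and the receiver sets `R j`, is a binary linear
network code for the multiple multicast problem: the messages are determined by the transmitted
bits `x` (this is automatic if `G` has no directed cycle), and every receiver in `R j` computes
the bit `x j`. Multiple unicast is the case in which every `R j` is a singleton. -/
def IsBinaryLinearNetworkCode (G : Digraph V) (t : Fin N → V) (R : Fin N → Set V) : Prop :=
  ∀ x : Fin N → ZMod 2,
    (∃! m, IsMessageAssignment G t x m) ∧
      ∀ m, IsMessageAssignment G t x m → ∀ j, ∀ r ∈ R j, m r = x j

open Classical in
/-- The largest in-degree or out-degree of a vertex of `G`. -/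
noncomputable def maxInOutDegree (G : Digraph V) : ℕ :=
  Finset.univ.sup fun v =>
    max (Finset.univ.filter (fun u => G.Adj u v)).card
      (Finset.univ.filter (fun w => G.Adj v w)).card

end NetworkCode

/-! ### Circuits on one qubit per vertex -/

/-- A (not necessarily normalised) vector in the space of the qubits indexed by `V`, given by its
amplitudes in the standard basis. -/
abbrev QState (V : Type*) := (V → ZMod 2) → ℂ

/-- The measurement outcomes obtained so far, layer by layer. The entry of a qubit that is not
measured in a layer is `0`; a measured qubit has entry `0` for the outcome `+1` and `1` for the
outcome `-1`. -/
abbrev Record (V : Type*) := List (V → ZMod 2)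

/-- The possible preparations of a qubit: `|0⟩` and `|+⟩`. -/
inductive Prep
  | zero
  | plus

/-- What a qubit does during one layer. `pauli a b` applies `X ^ a * Z ^ b` (`Z` first), where the
bits `a` and `b` may be arbitrary functions of the outcomes of the earlier layers; `a = b = 1` is a
`Y` gate up to a phase. -/
inductive Action (V : Type*)
  | idle
  | control (target : V)
  | target (control : V)
  | measureX
  | measureZ
  | pauli (a b : Record V → ZMod 2)

/-- The sign `(-1) ^ b`. -/
def sgn (b : ZMod 2) : ℂ := if b = 0 then 1 else -1

/-- The factor contributed by the qubit `v` to the matrix element `⟨x| K |z⟩` of a layer, when the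
outcomes of the earlier layers are `h` and the outcome at `v` is `o`. -/
noncomputable def Action.amp {V : Type*} (A : Action V) (h : Record V) (v : V) (o : ZMod 2)
    (x z : V → ZMod 2) : ℂ :=
  match A with
  | .idle => if o = 0 ∧ x v = z v then 1 else 0
  | .control _ => if o = 0 ∧ x v = z v then 1 else 0
  | .target c => if o = 0 ∧ x v = z v + z c then 1 else 0
  | .measureX => sgn (o * (x v + z v)) / 2
  | .measureZ => if x v = o ∧ z v = o then 1 else 0
  | .pauli a b => if o = 0 ∧ x v = z v + a h then sgn (b h * z v) else 0

/-- One time step: every qubit takes part in at most one operation. -/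
structure Layer (V : Type*) where
  act : V → Action V
  control_iff : ∀ u v, act u = .control v ↔ act v = .target u

/-- The vector after a layer with outcomes `o`: the result of applying to `ψ` the CNOT and Pauli
gates of the layer and the projectors that belong to the outcomes `o`. Its squared norm is, for
normalised `ψ`, the probability of `o`. -/
noncomputable def Layer.apply {V : Type*} [Fintype V] [DecidableEq V] (L : Layer V) (h : Record V)
    (o : V → ZMod 2) (ψ : QState V) : QState V :=
  fun x => ∑ z, (∏ v, (L.act v).amp h v (o v) x z) * ψ z

/-- The vector after the layers, for the outcomes in the second record, where the first record holds
the outcomes of the layers before. It is zero if the number of outcomes does not fit. -/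
noncomputable def runLayers {V : Type*} [Fintype V] [DecidableEq V] :
    List (Layer V) → Record V → Record V → QState V → QState V
  | [], _, [], ψ => ψ
  | L :: Ls, h, o :: os, ψ => runLayers Ls (h ++ [o]) os (L.apply h o ψ)
  | _, _, _, _ => 0

/-- A QLNC circuit: every qubit is prepared in `|0⟩` or `|+⟩`, and then layers of CNOT gates, `X` and
`Z` measurements, and Pauli gates conditioned on earlier outcomes are performed. -/
structure Circuit (V : Type*) where
  init : V → Prep
  layers : List (Layer V)

namespace Circuit

variable {V : Type*}

/-- The quantum depth: one time step for the preparations and one for each layer. -/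
def depth (C : Circuit V) : ℕ := 1 + C.layers.length

/-- Every CNOT of the circuit is located along an edge of `G`, from its tail to its head. -/
def CNOTsAlong (C : Circuit V) (G : Digraph V) : Prop :=
  ∀ L ∈ C.layers, ∀ u v, L.act u = .control v → G.Adj u v

variable [Fintype V]

/-- The state that is prepared at the beginning. -/
noncomputable def initState (C : Circuit V) : QState V := fun x =>
  ∏ v, match C.init v with
    | .zero => if x v = 0 then 1 else 0
    | .plus => 1 / (Real.sqrt 2 : ℂ)

/-- The unnormalised final state on the branch with measurement outcomes `o`; its squared norm is
the probability of this branch. -/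
noncomputable def finalState [DecidableEq V] (C : Circuit V) (o : Record V) : QState V :=
  runLayers C.layers [] o C.initState

end Circuit

/-! ### Bell and GHZ states -/

section Distribution

variable {V : Type*} {N : ℕ}

open Classical in
/-- The amplitude at `x` of the state `(|0…0⟩ + |1…1⟩) / √2` on the qubits in `S`: the state `|Φ⁺⟩`
if `S` has two elements, and the GHZ state if it has more. -/
noncomputable def ghzAmp (S : Set V) (x : V → ZMod 2) : ℂ :=
  ((if ∀ v ∈ S, x v = 0 then 1 else 0) + (if ∀ v ∈ S, x v = 1 then 1 else 0)) /
    (Real.sqrt 2 : ℂ)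

/-- The vertices that are neither transmitters nor receivers. -/
def relays (t : Fin N → V) (R : Fin N → Set V) : Set V :=
  {v | v ∉ Set.range t ∧ ∀ j, v ∉ R j}

/-- Whatever the measurement outcomes, the final state is the tensor product, over all `j`, of the
Bell or GHZ state on the transmitter `t j` and its receivers `R j`, with some state `φ` of the
relays (which absorbs the normalisation and the global phase, and vanishes only if the outcomes
have probability zero). -/
def Circuit.Distributes [Fintype V] [DecidableEq V] (C : Circuit V) (t : Fin N → V)
    (R : Fin N → Set V) : Prop :=
  ∀ o : Record V, ∃ φ : (relays t R → ZMod 2) → ℂ, ∀ x : V → ZMod 2,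
    C.finalState o x = (∏ j, ghzAmp (insert (t j) (R j)) x) * φ (fun v => x v)

end Distribution

end QLNC

set_option linter.unusedSectionVars false

/-! Before the X measurement, every vector of the circuit is a multiple of the uniform superposition
of the basis states in a set `D`. CNOTs act on `D` by an involution, and a Z measurement intersects
`D` with an affine condition. The quantum part thus reduces to linear algebra over the field with
two elements.

Consider the parities `x v + inSum G x v` at the non-transmitters. If all of them are fixed, `x` is
a message assignment plus a constant: `parityMap G` is invertible because messages are unique, and
the transmitter bits stay free. The receivers then hold the transmitter bits up to constants
(`exists_affine_parametrization`). Measuring X on the relays leaves only a sign linear in the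
transmitter bits. Z gates on transmitters remove the sign, and X gates remove the constants
(`isCorrectable_xLayer`).

For the depth, the vertices of one colour receive from all their in-neighbours in one pass of
`maxInOutDegree G` CNOT layers, by König's theorem (`exists_perms_cover`, `passLayers_takes`). For
colours at least 2 the parity is measured between two passes, the second undoing the first
(`parityLayers_takes`). Colours 0 and 1 need one pass each. Colour 0 is prepared in `|0⟩` off the
transmitters, so its parities vanish after its pass. Colour 1 comes last and is never uncomputed:
its relays are measured, and its receivers, prepared in `|0⟩`, keep what they receive. With `m + 2`
colours this makes `2 * (m + 1)` passes. -/

namespace QLNC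

/-! ### Edge colouring by permutations -/

section Decomposition

variable {V : Type*} [Fintype V] [DecidableEq V]

/-- The support of a regular matrix of natural numbers contains a permutation. -/
theorem exists_perm_of_regular {d : ℕ} (hd : 0 < d) (M : V → V → ℕ)
    (hr : ∀ u, ∑ v, M u v = d) (hc : ∀ v, ∑ u, M u v = d) :
    ∃ σ : Equiv.Perm V, ∀ u, M u (σ u) ≠ 0 := by
  let f (u : V) : Finset V := Finset.univ.filter fun v => M u v ≠ 0
  -- Hall's condition by double counting: the rows in `A` have total weight `A.card * d`, all of it
  -- in the columns of `A.biUnion f`, which can hold only `(A.biUnion f).card * d`.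
  have hf (A : Finset V) : A.card ≤ (A.biUnion f).card := by
    have h (u : V) : ∑ v ∈ f u, M u v = d := by
      rw [← hr u]
      exact Finset.sum_subset (Finset.filter_subset _ _) (by simp [f])
    have h₁ : ∑ u ∈ A, ∑ v ∈ f u, M u v = A.card * d := by simp [h]
    have h₂ : ∑ u, ∑ v ∈ A.biUnion f, M u v = (A.biUnion f).card * d := by
      rw [Finset.sum_comm]; simp [hc]
    refine le_of_mul_le_mul_right ?_ hd
    rw [← h₁, ← h₂]
    trans ∑ u ∈ A, ∑ v ∈ A.biUnion f, M u v
    · exact Finset.sum_le_sum fun u hu =>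
        Finset.sum_le_sum_of_subset (Finset.subset_biUnion_of_mem f hu)
    · exact Finset.sum_le_sum_of_subset (Finset.subset_univ A)
  obtain ⟨g, hg, hg'⟩ := (Finset.all_card_le_biUnion_card_iff_exists_injective f).1 hf
  refine ⟨Equiv.ofBijective g (Finite.injective_iff_bijective.1 hg), fun u => ?_⟩
  simpa [f] using hg' u

/-- A `d`-regular matrix of natural numbers is covered by `d` permutations. -/
theorem exists_perms_of_regular (d : ℕ) (M : V → V → ℕ)
    (hr : ∀ u, ∑ v, M u v = d) (hc : ∀ v, ∑ u, M u v = d) :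
    ∃ σ : Fin d → Equiv.Perm V, ∀ u v, M u v ≠ 0 → ∃ i, σ i u = v := by
  induction d generalizing M with
  | zero =>
    refine ⟨fun _ => 1, fun u v h => absurd ?_ h⟩
    exact (Finset.sum_eq_zero_iff.1 (hr u)) v (Finset.mem_univ v)
  | succ d ih =>
    obtain ⟨σ, hσ⟩ := exists_perm_of_regular d.succ_pos M hr hc
    have hle (u v : V) : (if σ u = v then 1 else 0) ≤ M u v := by
      split_ifs with h
      · subst h; exact Nat.one_le_iff_ne_zero.2 (hσ u)
      · exact Nat.zero_le _
    obtain ⟨τ, hτ⟩ := ih (fun u v => M u v - if σ u = v then 1 else 0)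
      (fun u => by
        rw [Finset.sum_tsub_distrib _ fun v _ => hle u v, hr]; simp)
      (fun v => by
        rw [Finset.sum_tsub_distrib _ fun u _ => hle u v, hc]
        simp [← Equiv.eq_symm_apply])
    refine ⟨Fin.cons σ τ, fun u v h => ?_⟩
    by_cases huv : σ u = v
    · exact ⟨0, huv⟩
    · obtain ⟨i, hi⟩ := hτ u v (by simpa [huv] using h)
      exact ⟨i.succ, hi⟩

/-- A matrix of natural numbers with row and column sums at most `d` is dominated by a `d`-regular
one. -/
theorem exists_regular_ge (d : ℕ) (M : V → V → ℕ)
    (hr : ∀ u, ∑ v, M u v ≤ d) (hc : ∀ v, ∑ u, M u v ≤ d) :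
    ∃ M' : V → V → ℕ, (∀ u v, M u v ≤ M' u v) ∧ (∀ u, ∑ v, M' u v = d) ∧
      ∀ v, ∑ u, M' u v = d := by
  induction hk : ∑ u, (d - ∑ v, M u v) generalizing M with
  | zero =>
    have hr' : ∀ u, ∑ v, M u v = d := fun u => by
      have := (Finset.sum_eq_zero_iff.1 hk) u (Finset.mem_univ u)
      have := hr u
      omega
    refine ⟨M, fun _ _ => le_rfl, hr', fun v => ?_⟩
    have h : ∑ v, ∑ u, M u v = ∑ _v : V, d := by
      rw [Finset.sum_comm]; exact Finset.sum_congr rfl fun u _ => hr' u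
    exact (Finset.sum_eq_sum_iff_of_le fun v _ => hc v).1 h v (Finset.mem_univ v)
  | succ k ih =>
    obtain ⟨u, hu⟩ : ∃ u, ∑ v, M u v < d := by
      by_contra! h
      have : ∑ u, (d - ∑ v, M u v) = 0 :=
        Finset.sum_eq_zero fun u _ => Nat.sub_eq_zero_of_le (h u)
      omega
    -- Row sums and column sums have the same total, so a deficient row forces a deficient column.
    -- Raising the entry where they meet lowers the total deficit by one.
    obtain ⟨v, hv⟩ : ∃ v, ∑ u, M u v < d := by
      by_contra! h
      have h1 : ∑ u, ∑ v, M u v < ∑ _u : V, d :=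
        Finset.sum_lt_sum (fun u _ => hr u) ⟨u, Finset.mem_univ u, hu⟩
      rw [Finset.sum_comm] at h1
      exact absurd h1 (not_lt.2 (Finset.sum_le_sum fun v _ => h v))
    have hrow (w : V) : ∑ z, (M w z + if w = u ∧ z = v then 1 else 0) =
        ∑ z, M w z + if w = u then 1 else 0 := by
      rw [Finset.sum_add_distrib]
      by_cases hw : w = u <;> simp [hw]
    have hcol (z : V) : ∑ w, (M w z + if w = u ∧ z = v then 1 else 0) =
        ∑ w, M w z + if z = v then 1 else 0 := by
      rw [Finset.sum_add_distrib]
      by_cases hz : z = v <;> simp [hz]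
    obtain ⟨M', h1, h2⟩ := ih (fun w z => M w z + if w = u ∧ z = v then 1 else 0)
      (fun w => by
        rw [hrow]; split_ifs with h
        · subst h; exact hu
        · exact hr w)
      (fun z => by
        rw [hcol]; split_ifs with h
        · subst h; exact hv
        · exact hc z)
      (by
        rw [← Finset.add_sum_erase _ _ (Finset.mem_univ u)] at hk ⊢
        rw [hrow, if_pos rfl]
        have he : ∀ w ∈ Finset.univ.erase u,
            d - ∑ z, (M w z + if w = u ∧ z = v then 1 else 0) = d - ∑ z, M w z := fun w hw => by
          rw [hrow, if_neg (Finset.ne_of_mem_erase hw), add_zero]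
        rw [Finset.sum_congr rfl he]
        omega)
    exact ⟨M', fun w z => (Nat.le_add_right _ _).trans (h1 w z), h2⟩

open Classical in
/-- **König's edge colouring theorem**, for the bipartite double cover of a directed graph: the
edges are covered by as many permutations as the largest in- or out-degree. -/
theorem exists_perms_cover (G : Digraph V) :
    ∃ σ : Fin (maxInOutDegree G) → Equiv.Perm V, ∀ u v, G.Adj u v → ∃ i, σ i u = v := by
  have hdeg (v : V) : max (Finset.univ.filter (fun u => G.Adj u v)).card
      (Finset.univ.filter (fun w => G.Adj v w)).card ≤ maxInOutDegree G := Finset.le_sup (f := fun v =>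
    max (Finset.univ.filter (fun u => G.Adj u v)).card
      (Finset.univ.filter (fun w => G.Adj v w)).card) (Finset.mem_univ v)
  obtain ⟨M, hM, hr, hc⟩ := exists_regular_ge (maxInOutDegree G)
    (fun u v => if G.Adj u v then 1 else 0)
    (fun u => by simpa using (le_max_right _ _).trans (hdeg u))
    (fun v => by simpa using (le_max_left _ _).trans (hdeg v))
  obtain ⟨σ, hσ⟩ := exists_perms_of_regular _ M hr hc
  refine ⟨σ, fun u v h => hσ u v ?_⟩
  have := hM u v
  rw [if_pos h] at this
  omega

end Decomposition

/-! ### Layers acting on uniform superpositions -/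

section Circuits

variable {V : Type*}

/-- The vector `ψ` is a multiple of the uniform superposition of the basis states in `D`. -/
def IsUniformOn (D : Set (V → ZMod 2)) (ψ : QState V) : Prop :=
  ∃ C : ℂ, (∀ x ∈ D, ψ x = C) ∧ ∀ x ∉ D, ψ x = 0

variable [Fintype V] [DecidableEq V]

/-- The layers `Ls` take every vector with the property `P` to one with the property `Q`, whatever
the outcomes are. -/
def Takes : List (Layer V) → (QState V → Prop) → (QState V → Prop) → Prop
  | [], P, Q => ∀ ψ, P ψ → Q ψ
  | L :: Ls, P, Q => ∃ P' : QState V → Prop,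
      (∀ h o ψ, P ψ → P' (L.apply h o ψ)) ∧ Takes Ls P' Q

theorem Takes.append {Ls Ls' : List (Layer V)} {P Q S : QState V → Prop}
    (h : Takes Ls P Q) (h' : Takes Ls' Q S) : Takes (Ls ++ Ls') P S := by
  induction Ls generalizing P with
  | nil =>
    cases Ls' with
    | nil => exact fun ψ hψ => h' ψ (h ψ hψ)
    | cons L Ls' =>
      obtain ⟨P', h1, h2⟩ := h'
      exact ⟨P', fun k o ψ hψ => h1 k o ψ (h ψ hψ), h2⟩
  | cons L Ls ih =>
    obtain ⟨P', h1, h2⟩ := h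
    exact ⟨P', h1, ih h2⟩

theorem takes_singleton {L : Layer V} {P Q : QState V → Prop}
    (h : ∀ k o ψ, P ψ → Q (L.apply k o ψ)) : Takes [L] P Q :=
  ⟨Q, h, fun _ => id⟩

/-- The condition `Q 0` covers the records of the wrong length, on which `runLayers` is zero by
definition. -/
theorem Takes.runLayers {Ls : List (Layer V)} {P Q : QState V → Prop} (h : Takes Ls P Q)
    (h0 : Q 0) (k o : Record V) {ψ : QState V} (hψ : P ψ) : Q (runLayers Ls k o ψ) := by
  induction Ls generalizing k o ψ P with
  | nil =>
    cases o with
    | nil => exact h ψ hψ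
    | cons o os => exact h0
  | cons L Ls ih =>
    obtain ⟨P', h1, h2⟩ := h
    cases o with
    | nil => exact h0
    | cons o os => exact ih h2 _ _ (h1 _ _ _ hψ)

/-- Running layers followed by one last layer. -/
theorem runLayers_concat (Ls : List (Layer V)) (L : Layer V) (h o : Record V) (ψ : QState V) :
    runLayers (Ls ++ [L]) h o ψ = 0 ∨ ∃ o₁ o₂,
      runLayers (Ls ++ [L]) h o ψ = L.apply (h ++ o₁) o₂ (runLayers Ls h o₁ ψ) := by
  induction Ls generalizing h o ψ with
  | nil =>
    match o with
    | [] => exact Or.inl rfl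
    | [o] => exact Or.inr ⟨[], o, by simp [runLayers]⟩
    | _ :: _ :: _ => exact Or.inl rfl
  | cons L' Ls ih =>
    cases o with
    | nil => exact Or.inl rfl
    | cons o os =>
      refine (ih (h ++ [o]) os (L'.apply h o ψ)).imp id ?_
      rintro ⟨o₁, o₂, e⟩
      refine ⟨o :: o₁, o₂, ?_⟩
      simpa [runLayers] using e

/-- If only one basis state `z` contributes to the amplitude at `x`, then the sum over the basis
states is a single term. -/
theorem Layer.apply_eq_single (L : Layer V) (h : Record V) (o : V → ZMod 2) (ψ : QState V)
    (x z : V → ZMod 2) (hz : ∀ y, y ≠ z → ∃ v, (L.act v).amp h v (o v) x y = 0) :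
    L.apply h o ψ x = (∏ v, (L.act v).amp h v (o v) x z) * ψ z := by
  refine Finset.sum_eq_single z (fun y _ hy => ?_) (by simp)
  obtain ⟨v, hv⟩ := hz y hy
  rw [Finset.prod_eq_zero (Finset.mem_univ v) hv, zero_mul]

theorem sum_self_zmod_two (a : ZMod 2) : a + a = 0 := CharTwo.add_self_eq_zero a

open Classical in
/-- The CNOT gates with the controls `u ∈ B` and the targets `σ u`. -/
noncomputable def cnotLayer (σ : Equiv.Perm V) (B : Set V) (hB : ∀ u ∈ B, σ u ∉ B) : Layer V where
  act v := if v ∈ B then .control (σ v) else if σ.symm v ∈ B then .target (σ.symm v) else .idle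
  control_iff u v := by
    by_cases hu : u ∈ B
    · by_cases hv : v ∈ B
      · simp only [hu, hv, if_true, reduceCtorEq, iff_false, Action.control.injEq]
        rintro rfl
        exact hB u hu hv
      · by_cases h : σ.symm v ∈ B
        · simp only [hu, hv, h, if_true, if_false, Action.control.injEq, Action.target.injEq]
          rw [Equiv.symm_apply_eq, eq_comm]
        · simp only [hu, hv, h, if_true, if_false, reduceCtorEq, iff_false, Action.control.injEq]
          rintro rfl
          exact h (by simpa using hu)
    · by_cases hv : v ∈ B
      · simp [hu, hv]; split_ifs <;> simp
      · by_cases h : σ.symm v ∈ B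
        · simp only [hu, hv, h, if_true, if_false, Action.target.injEq]
          constructor
          · split_ifs <;> simp
          · rintro rfl; exact absurd h hu
        · simp [hu, hv, h]; split_ifs <;> simp

open Classical in
/-- The action of `cnotLayer` on the basis states; it is an involution. -/
noncomputable def cnotMap (σ : Equiv.Perm V) (B : Set V) (x : V → ZMod 2) : V → ZMod 2 :=
  fun v => x v + if v ∉ B ∧ σ.symm v ∈ B then x (σ.symm v) else 0

/-- A CNOT layer permutes the basis states by an involution, so the image of `D` may be written as a
preimage. A nonzero outcome entry, impossible without measurements, gives the multiple zero. -/
theorem cnotLayer_isUniformOn (σ : Equiv.Perm V) (B : Set V) (hB : ∀ u ∈ B, σ u ∉ B)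
    {D : Set (V → ZMod 2)} (h : Record V) (o : V → ZMod 2) {ψ : QState V}
    (hψ : IsUniformOn D ψ) :
    IsUniformOn (cnotMap σ B ⁻¹' D) ((cnotLayer σ B hB).apply h o ψ) := by
  have key (x : V → ZMod 2) : (cnotLayer σ B hB).apply h o ψ x =
      (if o = 0 then 1 else 0) * ψ (cnotMap σ B x) := by
    rw [Layer.apply_eq_single _ _ _ _ _ (cnotMap σ B x)]
    · congr 1
      split_ifs with ho
      · subst ho
        refine Finset.prod_eq_one fun v _ => ?_
        by_cases hv : v ∈ B
        · simp [cnotLayer, hv, Action.amp, cnotMap]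
        · by_cases hs : σ.symm v ∈ B
          · simp [cnotLayer, hv, hs, Action.amp, cnotMap, add_assoc, sum_self_zmod_two]
          · simp [cnotLayer, hv, hs, Action.amp, cnotMap]
      · obtain ⟨v, hv⟩ := Function.ne_iff.1 ho
        refine Finset.prod_eq_zero (Finset.mem_univ v) ?_
        simp only [Pi.zero_apply] at hv
        simp only [cnotLayer]
        split_ifs <;> simp [Action.amp, hv]
    · intro y hy
      by_contra! hne
      refine hy ?_
      have hfix : ∀ v, ¬ (v ∉ B ∧ σ.symm v ∈ B) → x v = y v := fun v hv => by
        have := hne v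
        simp only [cnotLayer] at this
        split_ifs at this with h1 h2
        · simp only [Action.amp, ne_eq, ite_eq_right_iff, not_forall] at this
          exact this.1.2
        · exact absurd ⟨h1, h2⟩ hv
        · simp only [Action.amp, ne_eq, ite_eq_right_iff, not_forall] at this
          exact this.1.2
      funext v
      by_cases hv : v ∉ B ∧ σ.symm v ∈ B
      · have := hne v
        simp only [cnotLayer, hv.1, hv.2, if_true, if_false, Action.amp, ne_eq,
          ite_eq_right_iff, not_forall] at this
        have h1 := this.1.2
        have h2 := hfix (σ.symm v) (fun h => h.1 hv.2)
        simp [cnotMap, hv, h1, h2, add_assoc, sum_self_zmod_two]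
      · simp [cnotMap, hv, hfix v hv]
  obtain ⟨C, h1, h2⟩ := hψ
  refine ⟨(if o = 0 then 1 else 0) * C, fun x hx => ?_, fun x hx => ?_⟩
  · rw [key, h1 _ hx]
  · rw [key, h2 _ hx, mul_zero]

open Classical in
/-- The measurement of `Z` on the qubits in `M`. -/
noncomputable def zLayer (M : Set V) : Layer V where
  act v := if v ∈ M then .measureZ else .idle
  control_iff u v := by split_ifs <;> simp

theorem zLayer_isUniformOn (M : Set V) {D : Set (V → ZMod 2)} (h : Record V) (o : V → ZMod 2)
    {ψ : QState V} (hψ : IsUniformOn D ψ) :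
    IsUniformOn (D ∩ {x | ∀ v ∈ M, x v = o v}) ((zLayer M).apply h o ψ) := by
  have key (x : V → ZMod 2) : (zLayer M).apply h o ψ x =
      (∏ v, ((zLayer M).act v).amp h v (o v) x x) * ψ x := by
    refine Layer.apply_eq_single _ _ _ _ _ _ fun y hy => ?_
    by_contra! hne
    refine hy (funext fun v => ?_)
    have := hne v
    simp only [zLayer] at this
    split_ifs at this <;>
      simp only [Action.amp, ne_eq, ite_eq_right_iff, not_forall] at this
    · exact this.1.2.trans this.1.1.symm
    · exact this.1.2.symm
  obtain ⟨C, h1, h2⟩ := hψ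
  by_cases ho : ∀ v, v ∉ M → o v = 0
  · refine ⟨C, fun x hx => ?_, fun x hx => ?_⟩
    · rw [key, h1 _ hx.1, Finset.prod_eq_one, one_mul]
      intro v _
      by_cases hv : v ∈ M
      · simp [zLayer, hv, Action.amp, hx.2 v hv]
      · simp [zLayer, hv, Action.amp, ho v hv]
    · by_cases hD : x ∈ D
      · obtain ⟨v, hv, hne⟩ : ∃ v ∈ M, x v ≠ o v := by
          by_contra! hc
          exact hx ⟨hD, hc⟩
        rw [key, Finset.prod_eq_zero (Finset.mem_univ v), zero_mul]
        simp [zLayer, hv, Action.amp, hne]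
      · rw [key, h2 _ hD, mul_zero]
  · push Not at ho
    obtain ⟨v, hv, hne⟩ := ho
    have hz (x : V → ZMod 2) : (zLayer M).apply h o ψ x = 0 := by
      rw [key, Finset.prod_eq_zero (Finset.mem_univ v), zero_mul]
      simp [zLayer, hv, Action.amp, hne]
    exact ⟨0, fun x _ => hz x, fun x _ => hz x⟩

open Classical in
/-- The measurement of `X` on the qubits in `M`. -/
noncomputable def xLayer (M : Set V) : Layer V where
  act v := if v ∈ M then .measureX else .idle
  control_iff u v := by split_ifs <;> simp

/-- The Pauli gates `X ^ a * Z ^ b`. -/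
def pauliLayer (a b : Record V → V → ZMod 2) : Layer V where
  act v := .pauli (fun h => a h v) (fun h => b h v)
  control_iff u v := by simp

theorem sgn_add (a b : ZMod 2) : sgn (a + b) = sgn a * sgn b := by
  have h2 : ∀ a : ZMod 2, a = 0 ∨ a = 1 := by decide
  rcases h2 a with rfl | rfl <;> rcases h2 b with rfl | rfl <;> simp [sgn, sum_self_zmod_two]

theorem sgn_zero : sgn 0 = 1 := if_pos rfl

theorem sgn_mul_self (a : ZMod 2) : sgn a * sgn a = 1 := by
  rw [← sgn_add, sum_self_zmod_two, sgn_zero]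

theorem sgn_sum {ι : Type*} (s : Finset ι) (f : ι → ZMod 2) :
    sgn (∑ i ∈ s, f i) = ∏ i ∈ s, sgn (f i) := by
  classical
  induction s using Finset.induction_on with
  | empty => exact sgn_zero
  | insert i s hi ih => rw [Finset.sum_insert hi, Finset.prod_insert hi, sgn_add, ih]

theorem pauliLayer_apply (a b : Record V → V → ZMod 2) (h : Record V) (o : V → ZMod 2)
    (ψ : QState V) (x : V → ZMod 2) :
    (pauliLayer a b).apply h o ψ x =
      (if o = 0 then sgn (∑ v, b h v * (x v + a h v)) else 0) * ψ (fun v => x v + a h v) := by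
  rw [Layer.apply_eq_single _ _ _ _ _ (fun v => x v + a h v)]
  · congr 1
    split_ifs with ho
    · subst ho
      rw [sgn_sum]
      refine Finset.prod_congr rfl fun v _ => ?_
      simp [pauliLayer, Action.amp, add_assoc, sum_self_zmod_two]
    · obtain ⟨v, hv⟩ := Function.ne_iff.1 ho
      refine Finset.prod_eq_zero (Finset.mem_univ v) ?_
      simp only [Pi.zero_apply] at hv
      simp [pauliLayer, Action.amp, hv]
  · intro y hy
    by_contra! hne
    refine hy (funext fun v => ?_)
    have := hne v
    simp only [pauliLayer, Action.amp, ne_eq, ite_eq_right_iff, not_forall] at this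
    rw [this.1.2, add_assoc, sum_self_zmod_two, add_zero]

/-- After measuring `X` on `M`, the uniform superposition of an affine family of basis states that
is determined by its values outside `M` acquires signs. -/
theorem xLayer_apply (M : Set V) (h : Record V) (o : V → ZMod 2) {ψ : QState V}
    (x z : V → ZMod 2) (hz : ∀ y, (∀ v ∉ M, y v = x v) → y ≠ z → ψ y = 0) :
    (xLayer M).apply h o ψ x = (∏ v, ((xLayer M).act v).amp h v (o v) x z) * ψ z := by
  refine Finset.sum_eq_single z (fun y _ hy => ?_) (by simp)
  by_cases hyx : ∀ v ∉ M, y v = x v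
  · rw [hz y hyx hy, mul_zero]
  · push Not at hyx
    obtain ⟨v, hv, hne⟩ := hyx
    rw [Finset.prod_eq_zero (Finset.mem_univ v), zero_mul]
    simp [xLayer, hv, Action.amp, hne.symm]

end Circuits

section Circuits

variable {V : Type*} [Fintype V] [DecidableEq V]

theorem Takes.mono {Ls : List (Layer V)} {P Q Q' : QState V → Prop} (h : Takes Ls P Q)
    (hQ : ∀ ψ, Q ψ → Q' ψ) : Takes Ls P Q' := by
  induction Ls generalizing P with
  | nil => exact fun ψ hψ => hQ ψ (h ψ hψ)
  | cons L Ls ih =>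
    obtain ⟨P', h1, h2⟩ := h
    exact ⟨P', h1, ih h2⟩

/-- After a measurement the set `D` depends on the outcome; this lets the later layers be analysed
for one outcome at a time. -/
theorem takes_exists {ι : Type*} {Ls : List (Layer V)} {P : ι → QState V → Prop}
    {Q : QState V → Prop} (h : ∀ i, Takes Ls (P i) Q) : Takes Ls (fun ψ => ∃ i, P i ψ) Q := by
  induction Ls generalizing P with
  | nil => rintro ψ ⟨i, hψ⟩; exact h i ψ hψ
  | cons L Ls ih =>
    choose P' h1 h2 using h
    exact ⟨fun ψ => ∃ i, P' i ψ, fun k o ψ ⟨i, hψ⟩ => ⟨i, h1 i k o ψ hψ⟩, ih h2⟩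

end Circuits

/-! ### Passes into one colour class and parity measurements -/

section Passes

variable {V : Type*}

section

variable [Fintype V]

open Classical in
/-- The sum of the bits on the incoming edges of `v`. -/
noncomputable def inSum (G : Digraph V) (x : V → ZMod 2) (v : V) : ZMod 2 :=
  ∑ u ∈ Finset.univ.filter (fun u => G.Adj u v), x u

theorem inSum_congr (G : Digraph V) {x y : V → ZMod 2} {v : V}
    (h : ∀ u, G.Adj u v → x u = y u) : inSum G x v = inSum G y v :=
  Finset.sum_congr rfl fun u hu => h u (by simpa using hu)

/-- The vertices of colour `k` add the bits on their incoming edges to their own bits. -/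
noncomputable def receiveMap (G : Digraph V) (c : V → ℕ) (k : ℕ) (x : V → ZMod 2) :
    V → ZMod 2 :=
  fun v => if c v = k then x v + inSum G x v else x v

end

/-- The tails of the edges along `σ i` into vertices of colour `k` that are not covered by an
earlier permutation. -/
def senders (G : Digraph V) (c : V → ℕ) (k : ℕ) {d : ℕ} (σ : Fin d → Equiv.Perm V) (i : Fin d) :
    Set V :=
  {u | c (σ i u) = k ∧ G.Adj u (σ i u) ∧ ∀ i' < i, σ i' u ≠ σ i u}

variable {G : Digraph V} {c : V → ℕ} (hc : ∀ u v, G.Adj u v → c u ≠ c v) (k : ℕ) {d : ℕ}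
  (σ : Fin d → Equiv.Perm V)

include hc in
theorem color_ne_of_mem_senders {i : Fin d} {u : V} (hu : u ∈ senders G c k σ i) : c u ≠ k :=
  fun h => hc _ _ hu.2.1 (h.trans hu.1.symm)

include hc in
theorem apply_notMem_senders {i : Fin d} {u : V} (hu : u ∈ senders G c k σ i) (i' : Fin d) :
    σ i u ∉ senders G c k σ i' :=
  fun h => color_ne_of_mem_senders hc k σ h hu.1

variable [Fintype V] [DecidableEq V]

/-- The CNOT gates along all edges into the vertices of colour `k`. -/
noncomputable def passLayers : List (Layer V) :=
  (List.finRange d).map fun i =>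
    cnotLayer (σ i) (senders G c k σ i) fun _ hu => apply_notMem_senders hc k σ hu i

open Classical in
theorem cnotLayers_takes (l : List (Fin d)) (D : Set (V → ZMod 2)) :
    Takes (l.map fun i => cnotLayer (σ i) (senders G c k σ i)
        fun _ hu => apply_notMem_senders hc k σ hu i) (IsUniformOn D)
      (IsUniformOn ((fun x v => x v + (l.map fun i =>
        if (σ i).symm v ∈ senders G c k σ i then x ((σ i).symm v) else 0).sum) ⁻¹' D)) := by
  induction l generalizing D with
  | nil => simp [Takes]
  | cons i l ih =>
    refine ⟨_, fun h o ψ hψ => cnotLayer_isUniformOn _ _ _ h o hψ, ?_⟩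
    convert ih (cnotMap (σ i) (senders G c k σ i) ⁻¹' D) using 2
    ext x
    simp only [Set.mem_preimage]
    apply iff_of_eq
    congr 1
    funext v
    simp only [cnotMap, List.map_cons, List.sum_cons]
    by_cases hv : (σ i).symm v ∈ senders G c k σ i
    · have h1 : v ∉ senders G c k σ i := by
        simpa using apply_notMem_senders hc k σ hv i
      -- A sender does not have colour `k`, so its bit does not change during the pass. Hence the
      -- contributions of the layers simply add up.
      have h2 : (l.map fun i' => if (σ i').symm ((σ i).symm v) ∈ senders G c k σ i' then
          x ((σ i').symm ((σ i).symm v)) else 0).sum = 0 := by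
        refine List.sum_eq_zero fun a ha => ?_
        obtain ⟨i', -, rfl⟩ := List.mem_map.1 ha
        refine if_neg fun h => ?_
        exact color_ne_of_mem_senders hc k σ hv (by simpa using h.1)
      simp only [hv, h1, not_false_eq_true, and_self, if_true, h2, add_zero]
      ring
    · simp [hv]

/-- The permutations may overlap and contain non-edges. `senders` keeps each edge only in the first
permutation that covers it, so no CNOT is repeated and cancelled. -/
theorem passLayers_takes (hσ : ∀ u v, G.Adj u v → ∃ i, σ i u = v) (D : Set (V → ZMod 2)) :
    Takes (passLayers hc k σ) (IsUniformOn D) (IsUniformOn (receiveMap G c k ⁻¹' D)) := by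
  classical
  unfold passLayers
  convert cnotLayers_takes hc k σ (List.finRange d) D using 3
  funext x v
  rw [← Fin.sum_univ_def, receiveMap]
  split_ifs with hv
  · congr 1
    rw [← Finset.sum_filter, inSum]
    symm
    refine Finset.sum_bij (fun i _ => (σ i).symm v) (fun i hi => ?_) (fun i hi j hj h => ?_)
      (fun u hu => ?_) fun _ _ => rfl
    · simp only [Finset.mem_filter, Finset.mem_univ, true_and] at hi ⊢
      simpa using hi.2.1
    · simp only [Finset.mem_filter, Finset.mem_univ, true_and] at hi hj
      rcases lt_trichotomy i j with hij | hij | hij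
      · exact absurd (by rw [Equiv.apply_symm_apply, ← h, Equiv.apply_symm_apply]) (hj.2.2 i hij)
      · exact hij
      · exact absurd (by rw [Equiv.apply_symm_apply, h, Equiv.apply_symm_apply]) (hi.2.2 j hij)
    · simp only [Finset.mem_filter, Finset.mem_univ, true_and] at hu
      obtain ⟨i, hi, hmin⟩ := WellFounded.has_min (wellFounded_lt (α := Fin d))
        {i | σ i u = v} (hσ u v hu)
      have hi : σ i u = v := hi
      refine ⟨i, ?_, by rw [← hi]; simp⟩
      simp only [Finset.mem_filter, Finset.mem_univ, true_and]
      have hs : (σ i).symm v = u := by rw [← hi]; simp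
      rw [hs]
      exact ⟨by rw [hi, hv], by rwa [hi], fun i' hlt h => hmin i' (h.trans hi) hlt⟩
  · rw [Finset.sum_eq_zero, add_zero]
    exact fun i _ => if_neg fun h => hv (by simpa using h.1)

include hc in
theorem receiveMap_receiveMap (x : V → ZMod 2) :
    receiveMap G c k (receiveMap G c k x) = x := by
  funext v
  by_cases hv : c v = k
  · have h : inSum G (receiveMap G c k x) v = inSum G x v :=
      inSum_congr G fun u hu => if_neg fun h => hc u v hu (h.trans hv.symm)
    rw [receiveMap, if_pos hv, h, receiveMap, if_pos hv, add_assoc, sum_self_zmod_two, add_zero]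
  · rw [receiveMap, if_neg hv, receiveMap, if_neg hv]

/-- The measurement of the parities `x v + inSum G x v` at the vertices `v ∉ T` of colour `k`. -/
noncomputable def parityLayers (T : Set V) : List (Layer V) :=
  passLayers hc k σ ++ ([zLayer {v | v ∉ T ∧ c v = k}] ++ passLayers hc k σ)

/-- The first pass writes the parity into the qubit `v`, where Z is measured. The second pass
restores the bits, since `receiveMap` is an involution for a proper colouring. -/
theorem parityLayers_takes (hσ : ∀ u v, G.Adj u v → ∃ i, σ i u = v) (T : Set V)
    (D : Set (V → ZMod 2)) :
    Takes (parityLayers hc k σ T) (IsUniformOn D) (fun ψ => ∃ o : V → ZMod 2,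
      IsUniformOn (D ∩ {x | ∀ v, v ∉ T → c v = k → x v + inSum G x v = o v}) ψ) := by
  refine (passLayers_takes hc k σ hσ D).append (Takes.append (Q := fun ψ => ∃ o : V → ZMod 2,
    IsUniformOn (receiveMap G c k ⁻¹' D ∩ {x | ∀ v ∈ {v | v ∉ T ∧ c v = k}, x v = o v}) ψ)
    (takes_singleton fun h o ψ hψ => ⟨o, zLayer_isUniformOn _ h o hψ⟩) ?_)
  refine takes_exists fun o => (passLayers_takes hc k σ hσ _).mono fun ψ hψ => ⟨o, ?_⟩
  convert hψ using 1
  ext x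
  simp only [Set.mem_inter_iff, Set.mem_preimage, receiveMap_receiveMap hc, Set.mem_ofPred_eq,
    and_imp]
  refine and_congr_right fun _ => forall_congr' fun v => forall_congr' fun _ =>
    forall_congr' fun hv => ?_
  simp [receiveMap, hv]

theorem parityLayers_range_takes (hσ : ∀ u v, G.Adj u v → ∃ i, σ i u = v) (T : Set V)
    (D : Set (V → ZMod 2)) (m : ℕ) :
    Takes ((List.range m).flatMap fun k => parityLayers hc (k + 2) σ T) (IsUniformOn D)
      (fun ψ => ∃ o : V → ZMod 2, IsUniformOn
        (D ∩ {x | ∀ v, v ∉ T → 2 ≤ c v → c v < m + 2 → x v + inSum G x v = o v}) ψ) := by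
  induction m with
  | zero =>
    refine fun ψ hψ => ⟨0, ?_⟩
    convert hψ using 1
    refine Set.inter_eq_left.2 fun x _ v _ h1 h2 => ?_
    omega
  | succ m ih =>
    rw [List.range_succ, List.flatMap_append, List.flatMap_singleton]
    refine ih.append (takes_exists fun o => ?_)
    refine (parityLayers_takes hc (m + 2) σ hσ T _).mono ?_
    rintro ψ ⟨o', hψ⟩
    refine ⟨fun v => if c v = m + 2 then o' v else o v, ?_⟩
    convert hψ using 1
    ext x
    simp only [Set.mem_inter_iff, Set.mem_ofPred_eq, and_assoc]
    refine and_congr_right fun _ => ⟨fun h => ⟨fun v hv h1 h2 => ?_, fun v hv h1 => ?_⟩,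
      fun h v hv h1 h2 => ?_⟩
    · rw [h v hv h1 (by omega), if_neg (by omega)]
    · rw [h v hv (by omega) (by omega), if_pos h1]
    · split_ifs with h3
      · exact h.2 v hv h3
      · exact h.1 v hv h1 (by omega)

theorem length_passLayers : (passLayers hc k σ).length = d := by simp [passLayers]

theorem length_parityLayers (T : Set V) : (parityLayers hc k σ T).length = 2 * d + 1 := by
  simp [parityLayers, length_passLayers]; omega

theorem adj_of_mem_passLayers {L : Layer V} (hL : L ∈ passLayers hc k σ) {u v : V}
    (h : L.act u = .control v) : G.Adj u v := by
  obtain ⟨i, -, rfl⟩ := List.mem_map.1 hL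
  simp only [cnotLayer] at h
  split_ifs at h with h1
  · cases h
    exact h1.2.1

end Passes

/-! ### Linear algebra of the network code -/

section Network

variable {V : Type*} [Fintype V] {N : ℕ}

/-- The receivers. -/
def receivers (R : Fin N → Set V) : Set V := {v | ∃ j, v ∈ R j}

theorem mem_relays_iff {t : Fin N → V} {R : Fin N → Set V} {v : V} :
    v ∈ relays t R ↔ v ∉ Set.range t ∧ v ∉ receivers R := by
  simp [relays, receivers]

/-- The map that adds to every bit the bits on the incoming edges. -/
noncomputable def parityMap (G : Digraph V) : (V → ZMod 2) →ₗ[ZMod 2] (V → ZMod 2) where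
  toFun x v := x v + inSum G x v
  map_add' x y := by
    funext v
    simp only [inSum, Pi.add_apply, Finset.sum_add_distrib]
    ring
  map_smul' a x := by
    funext v
    simp only [inSum, Pi.smul_apply, smul_eq_mul, ← Finset.mul_sum, RingHom.id_apply]
    ring

open Classical in
/-- The vector with the entries `y j` at `t j`, and `0` elsewhere. -/
noncomputable def extend (t : Fin N → V) : (Fin N → ZMod 2) →ₗ[ZMod 2] (V → ZMod 2) where
  toFun y v := ∑ j, if t j = v then y j else 0
  map_add' x y := by
    funext v
    simp only [Pi.add_apply, ← Finset.sum_add_distrib]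
    exact Finset.sum_congr rfl fun j _ => by split_ifs <;> simp
  map_smul' a x := by
    funext v
    simp only [Pi.smul_apply, smul_eq_mul, Finset.mul_sum, RingHom.id_apply]
    exact Finset.sum_congr rfl fun j _ => by split_ifs <;> simp

theorem extend_apply {t : Fin N → V} (ht : Function.Injective t) (y : Fin N → ZMod 2)
    (j : Fin N) : extend t y (t j) = y j := by
  simp [extend, ht.eq_iff]

theorem extend_of_notMem {t : Fin N → V} (y : Fin N → ZMod 2) {v : V} (hv : v ∉ Set.range t) :
    extend t y v = 0 := by
  simp only [extend, LinearMap.coe_mk, AddHom.coe_mk]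
  exact Finset.sum_eq_zero fun j _ => if_neg fun h => hv ⟨j, h⟩

variable {G : Digraph V} {t : Fin N → V} {R : Fin N → Set V}

theorem inSum_transmitter (hin : ∀ j u, ¬ G.Adj u (t j)) (x : V → ZMod 2) (j : Fin N) :
    inSum G x (t j) = 0 :=
  Finset.sum_eq_zero fun u hu => absurd (by simpa using hu) (hin j u)

theorem isMessageAssignment_iff (ht : Function.Injective t) (hin : ∀ j u, ¬ G.Adj u (t j))
    (x : Fin N → ZMod 2) (m : V → ZMod 2) :
    IsMessageAssignment G t x m ↔ parityMap G m = extend t x := by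
  constructor
  · rintro ⟨h1, h2⟩
    funext v
    by_cases hv : v ∈ Set.range t
    · obtain ⟨j, rfl⟩ := hv
      rw [extend_apply ht]
      change m (t j) + inSum G m (t j) = x j
      rw [inSum_transmitter hin, add_zero, h1]
    · rw [extend_of_notMem x hv]
      change m v + inSum G m v = 0
      rw [h2 v hv]
      exact sum_self_zmod_two _
  · intro h
    have h' (v : V) : m v + inSum G m v = extend t x v := congrFun h v
    refine ⟨fun j => ?_, fun v hv => ?_⟩
    · rw [← extend_apply ht x j, ← h', inSum_transmitter hin, add_zero]
    · have := h' v
      rw [extend_of_notMem x hv] at this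
      exact CharTwo.add_eq_zero.1 this

/-- A kernel vector is a message assignment for the input zero, and so is the zero vector. -/
theorem parityMap_injective (ht : Function.Injective t) (hin : ∀ j u, ¬ G.Adj u (t j))
    (hcode : IsBinaryLinearNetworkCode G t R) : Function.Injective (parityMap G) := by
  refine (injective_iff_map_eq_zero _).2 fun m hm => ?_
  refine (hcode 0).1.unique ((isMessageAssignment_iff ht hin 0 m).2 ?_)
    ((isMessageAssignment_iff ht hin 0 0).2 ?_)
  · rw [hm, map_zero]
  · rw [map_zero, map_zero]

/-- The basis states that remain after all parities have been measured form an affine family that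
is parametrized by the bits of the transmitters, and in which the receivers hold these bits up to
constants. -/
theorem exists_affine_parametrization (ht : Function.Injective t)
    (hin : ∀ j u, ¬ G.Adj u (t j)) (hout : ∀ j, ∀ r ∈ R j, ∀ w, ¬ G.Adj r w)
    (hcode : IsBinaryLinearNetworkCode G t R) {c : V → ℕ} (hc : ∀ u v, G.Adj u v → c u ≠ c v)
    (o o' : V → ZMod 2) :
    ∃ (g : V → ZMod 2) (Λ : (Fin N → ZMod 2) →ₗ[ZMod 2] (V → ZMod 2)),
      (∀ j, g (t j) = 0) ∧ (∀ y j, Λ y (t j) = y j) ∧ (∀ y j, ∀ r ∈ R j, Λ y r = y j) ∧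
      receiveMap G c 1 ⁻¹' (receiveMap G c 0 ⁻¹'
          {x | ∀ v, v ∉ Set.range t → (c v = 0 ∨ c v = 1 ∧ v ∈ receivers R) → x v = 0} ∩
          {x | ∀ v, v ∉ Set.range t → 2 ≤ c v → x v + inSum G x v = o v}) ∩
        {x | ∀ v ∈ {v | v ∈ relays t R ∧ c v = 1}, x v = o' v} =
      {z | z = g + Λ (z ∘ t)} := by
  classical
  let Φ := LinearEquiv.ofInjectiveEndo (parityMap G) (parityMap_injective ht hin hcode)
  have hΦ (x : V → ZMod 2) (v : V) : Φ x v = x v + inSum G x v := rfl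
  let Q : Set V := {v | v ∈ relays t R ∧ c v = 1}
  have hQt (j : Fin N) : t j ∉ Q := fun h => (mem_relays_iff.1 h.1).1 ⟨j, rfl⟩
  have hQR {j : Fin N} {r : V} (hr : r ∈ R j) : r ∉ Q :=
    fun h => (mem_relays_iff.1 h.1).2 ⟨j, hr⟩
  -- The prescribed parities: zero where the preparation in `|0⟩` forces it, and measured outcomes
  -- elsewhere off the transmitters.
  let e : V → ZMod 2 := fun v => if v ∈ Set.range t then 0 else
    if c v = 0 then 0 else if c v = 1 then (if v ∈ receivers R then 0 else o' v) else o v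
  -- `Φ.symm (extend t y)` is the message assignment for `y`. On `Q` it is replaced by zero, because
  -- the relays of colour 1 end in the fixed states `o'` instead of holding their messages.
  let Λ : (Fin N → ZMod 2) →ₗ[ZMod 2] (V → ZMod 2) :=
    LinearMap.pi fun v => if v ∈ Q then 0 else
      (LinearMap.proj v).comp (Φ.symm.toLinearMap.comp (extend t))
  let g : V → ZMod 2 := fun v => if v ∈ Q then o' v else Φ.symm e v
  have hΛ (y : Fin N → ZMod 2) (v : V) :
      Λ y v = if v ∈ Q then 0 else Φ.symm (extend t y) v := by
    simp only [Λ, LinearMap.pi_apply]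
    split_ifs <;> rfl
  have hT (s : V → ZMod 2) (j : Fin N) : Φ s (t j) = s (t j) := by
    rw [hΦ, inSum_transmitter hin, add_zero]
  have hgΛ (y : Fin N → ZMod 2) (v : V) :
      (g + Λ y) v = if v ∈ Q then o' v else Φ.symm (extend t y + e) v := by
    rw [Pi.add_apply, hΛ, map_add, Pi.add_apply]
    simp only [g]
    split_ifs
    · rw [add_zero]
    · rw [add_comm]
  refine ⟨g, Λ, fun j => ?_, fun y j => ?_, fun y j r hr => ?_, ?_⟩
  · simp only [g, if_neg (hQt j)]
    rw [← hT (Φ.symm _), Φ.apply_symm_apply]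
    simp [e]
  · rw [hΛ, if_neg (hQt j), ← hT (Φ.symm _), Φ.apply_symm_apply, extend_apply ht]
  · rw [hΛ, if_neg (hQR hr)]
    exact (hcode y).2 _ ((isMessageAssignment_iff ht hin y _).2 (Φ.apply_symm_apply _)) j r hr
  ext z
  -- `s` is the configuration before the pass into colour 1, and `w` is the one whose parities are
  -- prescribed by `e`. They agree at every tail of an edge once `z` equals `o'` on `Q`, hence have
  -- equal incoming sums. At receivers of colour 1, `w` takes the received bit of `z`.
  let s := receiveMap G c 1 z
  let w : V → ZMod 2 := fun v => if v ∈ Q then o' v + inSum G z v else z v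
  have hwz {u v : V} (hv : c v = 1) (huv : G.Adj u v) : w u = z u :=
    if_neg fun h => hc u v huv (h.2.trans hv.symm)
  have hs1 {v : V} (hv : c v = 1) : s v = z v + inSum G z v := if_pos hv
  have hs2 {v : V} (hv : c v ≠ 1) : s v = z v := if_neg hv
  have hw2 {v : V} (hv : c v ≠ 1) : w v = z v := if_neg fun h => hv h.2
  have hws (hz : ∀ v ∈ Q, z v = o' v) {u v : V} (huv : G.Adj u v) : w u = s u := by
    by_cases hu : c u = 1
    · by_cases hut : u ∈ Set.range t
      · obtain ⟨j, rfl⟩ := hut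
        rw [hs1 hu, inSum_transmitter hin, add_zero]
        exact if_neg (hQt j)
      · have huQ : u ∈ Q := ⟨mem_relays_iff.2 ⟨hut, fun ⟨j, hj⟩ => hout j u hj v huv⟩, hu⟩
        rw [hs1 hu, hz u huQ]
        exact if_pos huQ
    · rw [hs2 hu, hw2 hu]
  have hsum (hz : ∀ v ∈ Q, z v = o' v) (v : V) : inSum G w v = inSum G s v :=
    inSum_congr G fun u hu => hws hz hu
  have h1 : z = g + Λ (z ∘ t) ↔ (∀ v ∈ Q, z v = o' v) ∧ Φ w = extend t (z ∘ t) + e := by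
    rw [← LinearEquiv.eq_symm_apply]
    set τ := Φ.symm (extend t (z ∘ t) + e) with hτ
    constructor
    · intro h
      have h' (v : V) := (congrFun h v).trans (hgΛ (z ∘ t) v)
      refine ⟨fun v hv => by rw [h', if_pos hv], funext fun v => ?_⟩
      by_cases hv : v ∈ Q
      · have h2 : Φ τ v = o' v := by
          rw [hτ, Φ.apply_symm_apply, Pi.add_apply,
            extend_of_notMem _ (mem_relays_iff.1 hv.1).1]
          simp only [e, if_neg (mem_relays_iff.1 hv.1).1, if_neg (mem_relays_iff.1 hv.1).2, hv.2,
            one_ne_zero, if_true, if_false, zero_add]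
        have h3 : inSum G z v = inSum G τ v := inSum_congr G fun u hu => by
          rw [h', if_neg fun h => hc u v hu (h.2.trans hv.2.symm)]
        rw [hΦ] at h2
        simp only [w, if_pos hv]
        rw [h3, ← h2, add_assoc, sum_self_zmod_two, add_zero]
      · simp only [w, if_neg hv]
        rw [h', if_neg hv]
    · rintro ⟨h2, h3⟩
      funext v
      rw [hgΛ]
      split_ifs with hv
      · exact h2 v hv
      · rw [← hτ, ← h3]
        exact (if_neg hv).symm
  have h2 : z ∈ {z | z = g + Λ (z ∘ t)} ↔ _ := h1
  rw [h2]
  simp only [Set.mem_inter_iff, Set.mem_preimage, Set.mem_ofPred_eq]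
  rw [and_comm]
  refine and_congr_right fun hz => ?_
  have hz : ∀ v ∈ Q, z v = o' v := hz
  change ((∀ v, v ∉ Set.range t → (c v = 0 ∨ c v = 1 ∧ v ∈ receivers R) →
    receiveMap G c 0 s v = 0) ∧ ∀ v, v ∉ Set.range t → 2 ≤ c v → s v + inSum G s v = o v) ↔ _
  have hcase (v : V) : c v = 0 ∨ c v = 1 ∨ 2 ≤ c v := by omega
  constructor
  · rintro ⟨hA, hB⟩
    funext v
    rw [hΦ, hsum hz, Pi.add_apply]
    by_cases hv : v ∈ Set.range t
    · obtain ⟨j, rfl⟩ := hv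
      rw [inSum_transmitter hin, add_zero, extend_apply ht]
      simp only [e, Set.mem_range_self, if_true, add_zero, w, if_neg (hQt j), Function.comp]
    · rw [extend_of_notMem _ hv, zero_add]
      simp only [e, if_neg hv]
      rcases hcase v with h | h | h
      · have := hA v hv (Or.inl h)
        rw [receiveMap, if_pos h, hs2 (by omega)] at this
        rw [if_pos h, hw2 (by omega), this]
      · rw [if_neg (by omega), if_pos h]
        have hi : inSum G s v = inSum G z v := by
          rw [← hsum hz]; exact inSum_congr G fun u hu => hwz h hu
        rw [hi]
        split_ifs with hr
        · have := hA v hv (Or.inr ⟨h, hr⟩)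
          rw [receiveMap, if_neg (by omega), hs1 h] at this
          rw [← this]
          congr 1
          exact if_neg fun hq => (mem_relays_iff.1 hq.1).2 hr
        · have hq : v ∈ Q := ⟨mem_relays_iff.2 ⟨hv, hr⟩, h⟩
          simp only [w, if_pos hq]
          rw [add_assoc, sum_self_zmod_two, add_zero]
      · rw [if_neg (by omega), if_neg (by omega), hw2 (by omega), ← hB v hv h, hs2 (by omega)]
  · intro h
    have h' (v : V) (hv : v ∉ Set.range t) : w v + inSum G s v = e v := by
      rw [← hsum hz, ← hΦ, h, Pi.add_apply, extend_of_notMem _ hv, zero_add]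
    refine ⟨fun v hv hcv => ?_, fun v hv hcv => ?_⟩
    · rcases hcv with hcv | ⟨hcv, hr⟩
      · rw [receiveMap, if_pos hcv, hs2 (by omega), ← hw2 (by omega), h' v hv]
        simp [e, hcv]
      · have hi : inSum G s v = inSum G z v := by
          rw [← hsum hz]; exact inSum_congr G fun u hu => hwz hcv hu
        have hq : v ∉ Q := fun hq => (mem_relays_iff.1 hq.1).2 hr
        have := h' v hv
        rw [hi] at this
        simp only [w, if_neg hq, e, if_neg hv, hcv, hr, if_true, one_ne_zero, if_false] at this
        rw [receiveMap, if_neg (by omega), hs1 hcv, this]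
    · rw [hs2 (by omega), ← hw2 (by omega), h' v hv]
      simp only [e, if_neg hv]
      rw [if_neg (by omega), if_neg (by omega)]

end Network

/-! ### X measurement, Pauli corrections and assembly of the circuit -/

section Final

variable {V : Type*} {N : ℕ}

open Classical in
theorem ghzAmp_insert (a : V) (S : Set V) (x : V → ZMod 2) :
    ghzAmp (insert a S) x = if ∀ r ∈ S, x r = x a then 1 / (Real.sqrt 2 : ℂ) else 0 := by
  have h01 : ∀ b : ZMod 2, b = 0 ∨ b = 1 := by decide
  simp only [ghzAmp, Set.mem_insert_iff, forall_eq_or_imp]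
  rcases h01 (x a) with h | h <;> simp only [h, zero_ne_one, one_ne_zero, true_and, false_and,
    if_false, zero_add, add_zero] <;> split_ifs <;> simp

/-- The product of the Bell and GHZ amplitudes on a basis state. -/
theorem prod_ghzAmp (t : Fin N → V) (R : Fin N → Set V) (x : V → ZMod 2)
    [Decidable (∀ j, ∀ r ∈ R j, x r = x (t j))] :
    ∏ j, ghzAmp (insert (t j) (R j)) x =
      if ∀ j, ∀ r ∈ R j, x r = x (t j) then (1 / (Real.sqrt 2 : ℂ)) ^ N else 0 := by
  split_ifs with h
  · rw [Finset.prod_congr rfl fun j _ => by rw [ghzAmp_insert, if_pos (h j)]]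
    simp
  · push Not at h
    obtain ⟨j, r, hr, hne⟩ := h
    refine Finset.prod_eq_zero (Finset.mem_univ j) ?_
    rw [ghzAmp_insert, if_neg fun h => hne (h r hr)]

theorem sqrt_two_pow_cancel (N : ℕ) (a : ℂ) :
    (1 / (Real.sqrt 2 : ℂ)) ^ N * ((Real.sqrt 2 : ℂ) ^ N * a) = a := by
  have h : (Real.sqrt 2 : ℂ) ≠ 0 := by simp
  rw [← mul_assoc, ← mul_pow, one_div, inv_mul_cancel₀ h, one_pow, one_mul]

variable [Fintype V] [DecidableEq V]

/-- Pauli gates can take `ψ` to a product of the Bell and GHZ states and a state of the relays. -/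
def IsCorrectable (t : Fin N → V) (R : Fin N → Set V) (ψ : QState V) : Prop :=
  ∃ (a b : V → ZMod 2) (φ : (relays t R → ZMod 2) → ℂ), ∀ x : V → ZMod 2,
    sgn (∑ v, b v * (x v + a v)) * ψ (fun v => x v + a v) =
      (∏ j, ghzAmp (insert (t j) (R j)) x) * φ (fun v => x v)

theorem isCorrectable_zero (t : Fin N → V) (R : Fin N → Set V) :
    IsCorrectable t R (0 : QState V) :=
  ⟨0, 0, 0, fun x => by simp⟩

variable {t : Fin N → V} {R : Fin N → Set V}

/-- Measuring X on a relay contributes the sign of `o v * (x v + z v)`, where `z v` is affine in the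
transmitter bits. The linear parts combine into a functional of these bits, which Z gates on the
transmitters cancel; what remains depends on the relays alone. -/
theorem isCorrectable_xLayer {g : V → ZMod 2}
    {Λ : (Fin N → ZMod 2) →ₗ[ZMod 2] (V → ZMod 2)} (hg : ∀ j, g (t j) = 0)
    (hΛt : ∀ y j, Λ y (t j) = y j) (hΛR : ∀ y j, ∀ r ∈ R j, Λ y r = y j) {ψ : QState V}
    (hψ : IsUniformOn {z | z = g + Λ (z ∘ t)} ψ) (h : Record V) (o : V → ZMod 2) :
    IsCorrectable t R ((xLayer (relays t R)).apply h o ψ) := by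
  classical
  obtain ⟨C, hC, h0⟩ := hψ
  have htr (j : Fin N) : t j ∉ relays t R := fun h => h.1 ⟨j, rfl⟩
  have hcase {v : V} (hv : v ∉ relays t R) : v ∈ Set.range t ∨ ∃ j, v ∈ R j := by
    by_contra! hcon
    exact hv ⟨hcon.1, hcon.2⟩
  have key (x : V → ZMod 2) : (xLayer (relays t R)).apply h o ψ x =
      (∏ v, ((xLayer (relays t R)).act v).amp h v (o v) x (g + Λ (x ∘ t))) * C := by
    have hz : (g + Λ (x ∘ t)) ∘ t = x ∘ t := funext fun j => by simp [hg, hΛt]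
    rw [xLayer_apply _ h o x (g + Λ (x ∘ t)), hC]
    · change _ = g + Λ ((g + Λ (x ∘ t)) ∘ t)
      rw [hz]
    · intro y hy hne
      refine h0 y fun hyD => hne ?_
      have hyt : y ∘ t = x ∘ t := funext fun j => hy _ (htr j)
      have hyD : y = g + Λ (y ∘ t) := hyD
      rwa [hyt] at hyD
  -- Outcomes that are nonzero at an unmeasured qubit give the zero vector.
  by_cases ho : ∀ v, v ∉ relays t R → o v = 0
  swap
  · push Not at ho
    obtain ⟨v, hv, hne⟩ := ho
    have : (xLayer (relays t R)).apply h o ψ = 0 := funext fun x => by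
      rw [key, Finset.prod_eq_zero (Finset.mem_univ v), zero_mul, Pi.zero_apply]
      simp [xLayer, hv, Action.amp, hne]
    rw [this]
    exact isCorrectable_zero t R
  let ℓ : (Fin N → ZMod 2) →ₗ[ZMod 2] ZMod 2 :=
    ∑ v, if v ∈ relays t R then o v • (LinearMap.proj v).comp Λ else 0
  have hℓ (y : Fin N → ZMod 2) : ℓ y = ∑ v, if v ∈ relays t R then o v * Λ y v else 0 := by
    simp only [ℓ, LinearMap.sum_apply]
    exact Finset.sum_congr rfl fun v _ => by split_ifs <;> simp
  let β : Fin N → ZMod 2 := fun j => ℓ fun i => if j = i then 1 else 0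
  have hβ (y : Fin N → ZMod 2) : ℓ y = ∑ j, y j * β j := by
    rw [LinearMap.pi_apply_eq_sum_univ ℓ y]
    simp [β]
  -- X gates are needed only at the receivers: `g` vanishes at the transmitters, and the relays may
  -- end in any state.
  let a : V → ZMod 2 := fun v => if v ∈ relays t R then 0 else g v
  have hat (j : Fin N) : a (t j) = 0 := by simp only [a, if_neg (htr j), hg]
  have hxa (x : V → ZMod 2) : (fun v => x v + a v) ∘ t = x ∘ t :=
    funext fun j => by simp [hat]
  have hsign (x : V → ZMod 2) :
      ∑ v, extend t β v * (x v + a v) = ℓ (x ∘ t) := by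
    rw [hβ]
    simp only [extend, LinearMap.coe_mk, AddHom.coe_mk, Finset.sum_mul]
    rw [Finset.sum_comm]
    refine Finset.sum_congr rfl fun j _ => ?_
    simp [hat, mul_comm]
  refine ⟨a, extend t β, fun y => (Real.sqrt 2 : ℂ) ^ N *
    ((∏ v, if hv : v ∈ relays t R then sgn (o v * (y ⟨v, hv⟩ + g v)) / 2 else 1) * C),
    fun x => ?_⟩
  rw [hsign, key, hxa, prod_ghzAmp]
  split_ifs with hx
  · rw [sqrt_two_pow_cancel, ← mul_assoc, hℓ, sgn_sum, ← Finset.prod_mul_distrib]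
    congr 1
    refine Finset.prod_congr rfl fun v _ => ?_
    by_cases hv : v ∈ relays t R
    · simp only [xLayer, if_pos hv, dif_pos hv, Action.amp, a, add_zero, Pi.add_apply]
      -- The sign of `o v * Λ (x ∘ t) v` occurs twice, once from the measurement and once from the Z
      -- correction, and cancels.
      rw [← add_assoc, mul_add (o v) (x v + g v), sgn_add,
        mul_comm (sgn (o v * (x v + g v))), ← mul_div_assoc, ← mul_assoc, sgn_mul_self, one_mul]
    · have hxv : x v = Λ (x ∘ t) v := by
        rcases hcase hv with ⟨j, rfl⟩ | ⟨j, hj⟩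
        · rw [hΛt]; rfl
        · rw [hΛR _ j v hj]; exact hx j v hj
      simp only [xLayer, if_neg hv, dif_neg hv, Action.amp, a, Pi.add_apply, ho v hv, sgn_zero,
        true_and]
      rw [if_pos (by rw [← hxv, add_comm]), mul_one]
  · push Not at hx
    obtain ⟨j, r, hr, hne⟩ := hx
    have hrr : r ∉ relays t R := fun h => h.2 j hr
    rw [zero_mul, Finset.prod_eq_zero (Finset.mem_univ r), zero_mul, mul_zero]
    simp only [xLayer, if_neg hrr, Action.amp, a, Pi.add_apply, ho r hrr, true_and]
    refine if_neg fun h => hne ?_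
    rw [hΛR _ j r hr, add_comm (x r)] at h
    exact add_left_cancel h

theorem initState_isUniformOn (Z : Set V) [DecidablePred (· ∈ Z)] (Ls : List (Layer V)) :
    IsUniformOn {x | ∀ v ∈ Z, x v = 0}
      (Circuit.initState ⟨fun v => if v ∈ Z then .zero else .plus, Ls⟩) := by
  refine ⟨∏ v, if v ∈ Z then 1 else 1 / (Real.sqrt 2 : ℂ), fun x hx => ?_, fun x hx => ?_⟩
  · refine Finset.prod_congr rfl fun v _ => ?_
    by_cases hv : v ∈ Z
    · simp [hv, hx v hv]
    · simp [hv]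
  · have hx : ¬ ∀ v ∈ Z, x v = 0 := hx
    push Not at hx
    obtain ⟨v, hv, hne⟩ := hx
    refine Finset.prod_eq_zero (Finset.mem_univ v) ?_
    simp [hv, hne]

/-- A circuit whose vectors are correctable distributes the Bell and GHZ states after a layer of
Pauli gates. -/
theorem exists_distributes (i : V → Prep) (Ls : List (Layer V))
    (h : ∀ k, IsCorrectable t R (runLayers Ls [] k (Circuit.initState ⟨i, Ls⟩))) :
    ∃ a b, Circuit.Distributes ⟨i, Ls ++ [pauliLayer a b]⟩ t R := by
  -- Choice over all records makes the Pauli exponents functions of the earlier outcomes.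
  choose a b φ hφ using h
  refine ⟨a, b, fun o => ?_⟩
  change ∃ φ : (relays t R → ZMod 2) → ℂ, ∀ x, runLayers (Ls ++ [pauliLayer a b]) [] o
    (Circuit.initState ⟨i, Ls⟩) x = _ * φ _
  rcases runLayers_concat Ls (pauliLayer a b) [] o (Circuit.initState ⟨i, Ls⟩) with
    h | ⟨o₁, o₂, h⟩
  · exact ⟨0, fun x => by simp [h]⟩
  · refine ⟨fun y => (if o₂ = 0 then 1 else 0) * φ o₁ y, fun x => ?_⟩
    rw [h, pauliLayer_apply]
    simp only [List.nil_append]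
    split_ifs
    · rw [hφ, one_mul]
    · simp

/-- If the network has a proper colouring with `m + 2` colours, then there is a circuit with
`2 * (m + 1) * maxInOutDegree G + m + 3` layers. -/
theorem exists_circuit_of_coloring (G : Digraph V) (ht : Function.Injective t)
    (hin : ∀ j u, ¬ G.Adj u (t j)) (hout : ∀ j, ∀ r ∈ R j, ∀ w, ¬ G.Adj r w)
    (hcode : IsBinaryLinearNetworkCode G t R) (c : V → ℕ) (hc : ∀ u v, G.Adj u v → c u ≠ c v)
    (m : ℕ) (hm : ∀ v, c v < m + 2) :
    ∃ C : Circuit V, C.CNOTsAlong G ∧ C.Distributes t R ∧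
      C.layers.length = 2 * (m + 1) * maxInOutDegree G + m + 3 := by
  classical
  obtain ⟨σ, hσ⟩ := exists_perms_cover G
  let Z : Set V := {v | v ∉ Set.range t ∧ (c v = 0 ∨ c v = 1 ∧ v ∈ receivers R)}
  let Ls : List (Layer V) := passLayers hc 0 σ ++
    (((List.range m).flatMap fun k => parityLayers hc (k + 2) σ (Set.range t)) ++
      (passLayers hc 1 σ ++ ([zLayer {v | v ∈ relays t R ∧ c v = 1}] ++ [xLayer (relays t R)])))
  have hLs : Takes Ls (IsUniformOn {x | ∀ v ∈ Z, x v = 0}) (IsCorrectable t R) := by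
    refine (passLayers_takes hc 0 σ hσ _).append
      ((parityLayers_range_takes hc σ hσ (Set.range t) _ m).append (takes_exists fun o =>
        (passLayers_takes hc 1 σ hσ _).append ((takes_singleton (Q := fun ψ => ∃ o', _)
          fun h o' ψ hψ => ⟨o', zLayer_isUniformOn _ h o' hψ⟩).append
            (takes_exists fun o' => takes_singleton fun h o'' ψ hψ => ?_))))
    obtain ⟨g, Λ, h1, h2, h3, h4⟩ := exists_affine_parametrization ht hin hout hcode hc o o'
    refine isCorrectable_xLayer h1 h2 h3 ?_ h o''
    rw [← h4]
    convert hψ using 5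
    · simp [Z]
    · simp [hm]
  obtain ⟨a, b, hab⟩ := exists_distributes (fun v => if v ∈ Z then .zero else .plus) Ls
    fun k => hLs.runLayers (isCorrectable_zero t R) [] k (initState_isUniformOn Z Ls)
  refine ⟨_, fun L hL u v huv => ?_, hab, ?_⟩
  · have hz (M : Set V) : (zLayer M).act u ≠ .control v := by
      simp only [zLayer]; split_ifs <;> simp
    have hx (M : Set V) : (xLayer M).act u ≠ .control v := by
      simp only [xLayer]; split_ifs <;> simp
    simp only [Ls, parityLayers, List.mem_append, List.mem_flatMap, List.mem_singleton] at hL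
    rcases hL with (hL | ⟨k, -, hL | rfl | hL⟩ | hL | rfl | rfl) | rfl
    · exact adj_of_mem_passLayers hc _ σ hL huv
    · exact adj_of_mem_passLayers hc _ σ hL huv
    · exact absurd huv (hz _)
    · exact adj_of_mem_passLayers hc _ σ hL huv
    · exact adj_of_mem_passLayers hc _ σ hL huv
    · exact absurd huv (hz _)
    · exact absurd huv (hx _)
    · simp [pauliLayer] at huv
  · simp only [Ls, List.length_append, List.length_flatMap, length_passLayers,
      length_parityLayers, List.map_const', List.sum_replicate, List.length_range,
      List.length_singleton, smul_eq_mul]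
    ring

/-- In a network without edges, the prepared state is as desired. -/
theorem exists_circuit_of_no_edges (G : Digraph V) (hG : ∀ u v, ¬ G.Adj u v)
    (hcode : IsBinaryLinearNetworkCode G t R) :
    ∃ C : Circuit V, C.CNOTsAlong G ∧ C.Distributes t R ∧ C.layers.length = 0 := by
  classical
  -- Without edges, a vertex that is not a transmitter always computes zero, and another transmitter
  -- holds a different bit on the input `Pi.single j 1`.
  have hR : ∀ j, ∀ r ∈ R j, r = t j := fun j r hr => by
    obtain ⟨⟨m, hm, -⟩, h⟩ := hcode (Pi.single j 1)
    have hmr := h m hm j r hr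
    rw [Pi.single_eq_same] at hmr
    by_cases hrt : r ∈ Set.range t
    · obtain ⟨i, rfl⟩ := hrt
      by_contra hne
      have hij : i ≠ j := fun h => hne (by rw [h])
      rw [hm.1 i, Pi.single_eq_of_ne hij] at hmr
      exact zero_ne_one hmr
    · rw [hm.2 r hrt, Finset.sum_eq_zero fun u hu => absurd (by simpa using hu) (hG u r)] at hmr
      exact absurd hmr zero_ne_one
  have hrel : relays t R = {v | v ∉ Set.range t} := by
    ext v
    refine ⟨fun h => h.1, fun h => ⟨h, fun j hj => h ⟨j, (hR j v hj).symm⟩⟩⟩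
  refine ⟨⟨fun v => if v ∈ relays t R then .zero else .plus, []⟩, by simp [Circuit.CNOTsAlong],
    fun o => ?_, rfl⟩
  cases o with
  | cons o os => exact ⟨0, fun x => by simp [Circuit.finalState, runLayers]⟩
  | nil =>
    obtain ⟨C, hC, h0⟩ := initState_isUniformOn (relays t R) []
    refine ⟨fun y => (Real.sqrt 2 : ℂ) ^ N * if ∀ v, y v = 0 then C else 0, fun x => ?_⟩
    rw [prod_ghzAmp, if_pos fun j r hr => by rw [hR j r hr], sqrt_two_pow_cancel]
    change Circuit.initState _ x = _
    split_ifs with h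
    · exact hC x fun v hv => h ⟨v, hv⟩
    · exact h0 x fun hx => h fun v => hx v v.2

end Final

end QLNC

theorem mainTheorem1 {V : Type*} [Fintype V] [DecidableEq V] [Nonempty V]
    (G : Digraph V) (hloop : ∀ v, ¬ G.Adj v v)
    (N : ℕ) (t : Fin N → V) (ht : Function.Injective t) (R : Fin N → Set V)
    (hin : ∀ j u, ¬ G.Adj u (t j))
    (hout : ∀ j, ∀ r ∈ R j, ∀ w, ¬ G.Adj r w)
    (hcode : QLNC.IsBinaryLinearNetworkCode G t R) :
    ∃ C : QLNC.Circuit V,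
      C.CNOTsAlong G ∧ C.Distributes t R ∧
        (C.depth : ℕ∞) ≤
          2 * (G.toSimpleGraphInclusive.chromaticNumber - 1) *
            ((QLNC.maxInOutDegree G : ℕ∞) + 2) + 1 := by
  have hadj {u v : V} (h : G.Adj u v) : G.toSimpleGraphInclusive.Adj u v :=
    ⟨fun e => hloop v (by rwa [e] at h), Or.inl h⟩
  obtain ⟨n, hn⟩ := ENat.ne_top_iff_exists.1
    (SimpleGraph.chromaticNumber_ne_top_iff_exists.2
      ⟨_, G.toSimpleGraphInclusive.colorable_of_fintype⟩)
  obtain ⟨c⟩ := SimpleGraph.chromaticNumber_le_iff_colorable.1 hn.symm.le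
  have hc (u v : V) (h : G.Adj u v) : (c u : ℕ) ≠ c v :=
    fun e => c.valid (hadj h) (Fin.ext e)
  rw [← hn]
  -- With fewer than two colours the bound is 1, so only the preparation step is available; but then
  -- there are no edges.
  rcases Nat.lt_or_ge n 2 with h2 | h2
  · obtain ⟨C, h1, h3, h4⟩ := QLNC.exists_circuit_of_no_edges (t := t) (R := R) G
      (fun u v h => by have := hc u v h; omega) hcode
    exact ⟨C, h1, h3, by simp [QLNC.Circuit.depth, h4]⟩
  · obtain ⟨m, rfl⟩ := Nat.exists_eq_add_of_le' h2
    obtain ⟨C, h1, h3, h4⟩ := QLNC.exists_circuit_of_coloring G ht hin hout hcode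
      (fun v => c v) hc m fun v => (c v).2
    refine ⟨C, h1, h3, ?_⟩
    rw [QLNC.Circuit.depth, h4, show ((m + 2 : ℕ) : ℕ∞) - 1 = ((m + 1 : ℕ) : ℕ∞) by
      rw [← Nat.cast_one, ← ENat.natCast_sub]; rfl]
    -- The depth is `2 * (m + 1) * maxInOutDegree G + m + 4`, which is `3 * m + 1` below the bound.
    norm_cast
    nlinarith
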